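/- Let $0\le K_A\le K_B\le M$ and $0\le N\le M$ be integers. In the Bayesian betting game $\mathrm{BGame}(N,K_A,K_B,M)$, Player II chooses a scenario $\theta\in\{A,B\}$ and a binary sequence of length $M$ with exactly $K_\theta$ ones. Player I, not knowing this choice, chooses a set of $N$ of the $M$ indices and observes the bits there, in order; depending on the observed sequence in $\{0,1\}^N$, she places a portion $p'\in[0,1]$ of her capital $1$ on $A$ and $1-p'$ on $B$. The portion placed on the chosen scenario is doubled, the other one is lost. Her utility is the logarithm of her final capital (with $\log 0=-\infty$) and the game is zero-sum. A mixed strategy is a probability measure on the actions of a player (for Player I: pairs of a sampling set and a map $\{0,1\}^N\to[0,1]$), and a Nash equilibrium is a pair of mixed strategies such that neither player can increase her expected utility by changing her own strategy. For $\theta\in\{A,B\}$ let $$\mathbb K_\theta=\{\max(0,N-(M-K_\theta)),\dots,\min(K_\theta,N)\},\qquad p_k(\theta)=\binom{K_\theta}{k}\binom{M-K_\theta}{N-k}\Big/\binom{M}{N},$$ and for $P\in[0,1]$ let $$\Delta G(P)=P\sum_{k\in\mathbb K_A}p_k(A)\log\frac{P\,p_k(A)}{P\,p_k(A)+(1-P)\,p_k(B)}+(1-P)\sum_{k\in\mathbb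 K_B}p_k(B)\log\frac{(1-P)\,p_k(B)}{P\,p_k(A)+(1-P)\,p_k(B)}$$ (with $0\log 0=0$). Assume that some observation is possible in both scenarios, i.e. $\mathbb K_A\cap\mathbb K_B\neq\emptyset$. Then: 1. $\Delta G$ has a unique minimiser $P^*$ on $[0,1]$, and $P^*\in(0,1)$. 2. For every $P\in[0,1]$, $\Delta G(P)=-H(\Pi\mid X)$, the negative of the conditional Shannon entropy, where $\Pr(\Pi=A)=P$, $\Pr(\Pi=B)=1-P$ and $\Pr(X=k\mid\Pi=\theta)=p_k(\theta)$. 3. Put $p'^*_k=\dfrac{P^*p_k(A)}{P^*p_k(A)+(1-P^*)p_k(B)}$ for $k\in\mathbb K_A\cup\mathbb K_B$. The following is a Nash equilibrium: Player II chooses $A$ with probability $P^*$ and $B$ with probability $1-P^*$, then picks uniformly one of the sequences allowed in that scenario; Player I picks the $N$ indices uniformly and, having observed $k$ ones, places the portion $p'^*_k$ on $A$ and $1-p'^*_k$ on $B$. 4. It is the unique Nash equilibrium of this symmetric form: if Player II chooses $A$ with probability $P\in[0,1]$ and then an allowed sequence uniformly, and Player I samples uniformly and places a portion $p'_k\in[0,1]$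 on $A$ after observing $k$ ones, and these strategies form a Nash equilibrium, then $P=P^*$ and $p'_k=p'^*_k$ for all $k\in\mathbb K_A\cup\mathbb K_B$. 5. Moreover, in every Nash equilibrium in mixed strategies, Player II chooses $A$ with probability $P^*$ and $B$ with probability $1-P^*$, and with probability one the policy of Player I places the portion $p'^*_k$ on $A$ after each sample with $k$ ones, for all $k\in\mathbb K_A\cup\mathbb K_B$. -/

import Mathlib

open MeasureTheory ProbabilityTheory Set

noncomputable section

/-! ## Two-player games in mixed strategies, with payoffs in `[-∞, ∞]` -/

/-- Expectation of an extended-real random variable: expectation of the positive part minus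
expectation of the negative part. In this file it is only used for variables one of whose two
parts is bounded, so that the difference is meaningful. -/
def extExpectation {Ω : Type*} [MeasurableSpace Ω] (μ : Measure Ω) (f : Ω → EReal) : EReal :=
  ((∫⁻ ω, (f ω).toENNReal ∂μ : ENNReal) : EReal) - ((∫⁻ ω, (-f ω).toENNReal ∂μ : ENNReal) : EReal)

/-- Expected payoff when the players independently draw their actions from the mixed strategies
`σ` and `τ`. -/
def expectedPayoff {X Y : Type*} [MeasurableSpace X] [MeasurableSpace Y] (u : X → Y → EReal)
    (σ : Measure X) (τ : Measure Y) : EReal :=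
  extExpectation (σ.prod τ) fun z => u z.1 z.2

/-- The mixed strategies `σ`, `τ` (probability measures on the sets of actions) form a Nash
equilibrium of the game with payoffs `u₁`, `u₂`: no player gains by a unilateral change of
mixed strategy. -/
def IsNashEquilibrium {X Y : Type*} [MeasurableSpace X] [MeasurableSpace Y]
    (u₁ u₂ : X → Y → EReal) (σ : Measure X) (τ : Measure Y) : Prop :=
  IsProbabilityMeasure σ ∧ IsProbabilityMeasure τ ∧
    (∀ σ' : Measure X, IsProbabilityMeasure σ' →
      expectedPayoff u₁ σ' τ ≤ expectedPayoff u₁ σ τ) ∧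
    (∀ τ' : Measure Y, IsProbabilityMeasure τ' →
      expectedPayoff u₂ σ τ' ≤ expectedPayoff u₂ σ τ)

/-! ## The Bayesian betting game -/

inductive Scenario : Type
  | A
  | B

instance : Fintype Scenario :=
  ⟨⟨[Scenario.A, Scenario.B], by simp⟩, fun θ => by cases θ <;> simp⟩

instance : MeasurableSpace Scenario := ⊤

/-- Binary sequences of length `n`. -/
abbrev Bits (n : ℕ) : Type := Fin n → Bool

/-- The number of `1`-s of a binary sequence. -/
def ones {n : ℕ} (b : Bits n) : ℕ := (Finset.univ.filter fun i => b i = true).card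

/-- The sets of `N` indices out of `M`. -/
abbrev Sampling (N M : ℕ) : Type := {S : Finset (Fin M) // S.card = N}

/-- The bits of `b` at the sampled indices, listed in increasing order of the index. -/
def observe {N M : ℕ} (S : Sampling N M) (b : Bits M) : Bits N :=
  fun i => b (S.1.orderEmbOfFin S.2 i)

/-- A policy assigns to every possible sample the portion of the capital placed on `A`. -/
abbrev Policy (N : ℕ) : Type := Bits N → unitInterval

/-- An action of the first player: the indices to sample, and a policy. -/
abbrev ActionI (N M : ℕ) : Type := Sampling N M × Policy N

/-- The prescribed number of `1`-s in each scenario. -/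
def quota (KA KB : ℕ) : Scenario → ℕ
  | Scenario.A => KA
  | Scenario.B => KB

/-- An action of the second player: a scenario, and a sequence allowed in it. -/
abbrev ActionII (KA KB M : ℕ) : Type :=
  {c : Scenario × Bits M // ones c.2 = quota KA KB c.1}

/-- The final capital, for initial capital `1`: the portion on the right scenario is doubled. -/
def finalCapital {N KA KB M : ℕ} (a : ActionI N M) (c : ActionII KA KB M) : ℝ :=
  match c.1.1 with
  | Scenario.A => 2 * (a.2 (observe a.1 c.1.2) : ℝ)
  | Scenario.B => 2 * (1 - (a.2 (observe a.1 c.1.2) : ℝ))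

/-- Logarithmic utility of the first player, equal to `-∞` when the capital is lost. -/
def payoffI {N KA KB M : ℕ} (a : ActionI N M) (c : ActionII KA KB M) : EReal :=
  ENNReal.log (ENNReal.ofReal (finalCapital a c))

/-- The game is zero-sum. -/
def payoffII {N KA KB M : ℕ} (a : ActionI N M) (c : ActionII KA KB M) : EReal :=
  -payoffI a c

/-- The Nash equilibria, in mixed strategies, of the Bayesian betting game. -/
def IsBGameNash (N KA KB M : ℕ) (σ : Measure (ActionI N M)) (τ : Measure (ActionII KA KB M)) :
    Prop :=
  IsNashEquilibrium payoffI payoffII σ τ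

/-! ## The symmetric strategies -/

/-- Sample `N` indices uniformly; place the portion `q k` on `A` if the sample has `k` ones. -/
def symmetricI (N M : ℕ) (q : ℕ → unitInterval) : Measure (ActionI N M) :=
  (uniformOn (univ : Set (Sampling N M))).map fun S => (S, fun d => q (ones d))

/-- The actions of the second player that choose scenario `θ`. -/
def choosing (KA KB M : ℕ) (θ : Scenario) : Set (ActionII KA KB M) := {c | c.1.1 = θ}

/-- Choose `A` with probability `P` and `B` with probability `1 - P`, then choose uniformly
among the sequences allowed in the chosen scenario. -/
def symmetricII (KA KB M : ℕ) (P : unitInterval) : Measure (ActionII KA KB M) :=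
  ENNReal.ofReal (P : ℝ) • uniformOn (choosing KA KB M Scenario.A) +
    ENNReal.ofReal (1 - (P : ℝ)) • uniformOn (choosing KA KB M Scenario.B)

/-! ## The parameters of the equilibrium -/

/-- The possible numbers of ones in a sample of size `N` from a sequence of length `M` with `K`
ones. -/
def sampleCounts (N K M : ℕ) : Finset ℕ := Finset.Icc (N - (M - K)) (min K N)

/-- Hypergeometric probability of `k` ones in the sample. -/
def hyperProb (N K M k : ℕ) : ℝ :=
  (K.choose k : ℝ) * ((M - K).choose (N - k) : ℝ) / (M.choose N : ℝ)

lemma hyperProb_nonneg (N K M k : ℕ) : 0 ≤ hyperProb N K M k := by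
  unfold hyperProb; positivity

/-- Bayes' rule: the posterior probability of `A` after `k` ones, for the prior `P`. -/
def bayesBet (N KA KB M : ℕ) (P : unitInterval) (k : ℕ) : unitInterval :=
  ⟨(P : ℝ) * hyperProb N KA M k /
      ((P : ℝ) * hyperProb N KA M k + (1 - (P : ℝ)) * hyperProb N KB M k), by
    have h1 := mul_nonneg P.2.1 (hyperProb_nonneg N KA M k)
    have h2 := mul_nonneg (sub_nonneg.2 P.2.2) (hyperProb_nonneg N KB M k)
    exact ⟨div_nonneg h1 (add_nonneg h1 h2),
      div_le_one_of_le₀ (le_add_of_nonneg_right h2) (add_nonneg h1 h2)⟩⟩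

/-- The growth rate difference `ΔG(P)`. -/
def growthDiff (N KA KB M : ℕ) (P : ℝ) : ℝ :=
  P * ∑ k ∈ sampleCounts N KA M, hyperProb N KA M k *
      Real.log (P * hyperProb N KA M k /
        (P * hyperProb N KA M k + (1 - P) * hyperProb N KB M k)) +
    (1 - P) * ∑ k ∈ sampleCounts N KB M, hyperProb N KB M k *
      Real.log ((1 - P) * hyperProb N KB M k /
        (P * hyperProb N KA M k + (1 - P) * hyperProb N KB M k))

/-- Conditional Shannon entropy `H(Y|X) = ∑ₓ Pr(X = x) H(Y | X = x)` of a joint distribution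
`j y x = Pr(Y = y, X = x)`, where `X` takes values in the finite set `s`. -/
def condEntropy {α κ : Type*} [Fintype α] (s : Finset κ) (j : α → κ → ℝ) : ℝ :=
  ∑ x ∈ s, (∑ y, j y x) * ∑ y, Real.negMulLog (j y x / ∑ y', j y' x)

/-- Joint law of the scenario and of the number of ones in the sample, for the prior `P`. -/
def jointLaw (N KA KB M : ℕ) (P : ℝ) : Scenario → ℕ → ℝ
  | Scenario.A, k => P * hyperProb N KA M k
  | Scenario.B, k => (1 - P) * hyperProb N KB M k

end

noncomputable section

/-! ## Logarithmic loss and Gibbs' inequality -/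

/-! Subtracting the payoff from `log 2` turns the game into one about a loss in `[0, ∞]`, where
Tonelli needs no integrability. Two symmetry facts reduce it to a bet on a binary hypothesis. If
Player I samples uniformly and bets by the number of ones, her loss depends on the opponent only
through the scenario chosen (`lintegral_actionLoss_symmetricI`). If Player II draws uniformly within
a scenario, the law of the sample does not depend on which indices are observed
(`lintegral_actionLoss_choosing`).

Let `h(P)` be the entropy of the scenario given the count, for the prior `P`. By Gibbs' inequality
every action loses at least `h(P)` against the symmetric strategy with prior `P`, with equality only
for the Bayes bets wherever the posterior is defined. The function `h` is continuous, vanishes at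
`0` and `1`, and is positive at `1/2` because some count is possible in both scenarios; so it has an
interior maximiser `P*`. Its derivative is the loss of the Bayes bets in `A` minus their loss in `B`
(`hasDerivAt_pairEntropy`). At `P*` the two losses agree, hence equal `h(P*)`: the Bayes bets lose
`h(P*)` against every opponent, and this gives the saddle point.

Uniqueness needs no concavity. If `h(Q) = h(P*)`, the equalising bets are optimal for the prior `Q`
as well, so strict Gibbs makes the posteriors for `Q` and `P*` coincide at a common count, and the
posterior is injective in the prior. Arbitrary equilibria are handled by interchanging their
strategies with those of the saddle point. -/

/-- The logarithmic loss `-log x`, equal to `∞` at `0`. -/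
def logLoss (x : ℝ) : ENNReal := if x ≤ 0 then ⊤ else ENNReal.ofReal (-Real.log x)

lemma logLoss_of_pos {x : ℝ} (hx : 0 < x) : logLoss x = ENNReal.ofReal (-Real.log x) :=
  if_neg hx.not_ge

lemma logLoss_of_nonpos {x : ℝ} (hx : x ≤ 0) : logLoss x = ⊤ := if_pos hx

lemma measurable_logLoss : Measurable logLoss :=
  Measurable.ite measurableSet_Iic measurable_const
    (Real.measurable_log.neg.ennreal_ofReal)

lemma logLoss_pos {x : ℝ} (hx : x < 1) : 0 < logLoss x := by
  rcases le_or_gt x 0 with h | h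
  · simp [logLoss_of_nonpos h]
  · rw [logLoss_of_pos h]
    simpa using Real.log_neg h hx

/-- The unnormalised entropy of a pair of weights. -/
def pairEntropy (a b : ℝ) : ℝ := Real.negMulLog a + Real.negMulLog b - Real.negMulLog (a + b)

lemma pairEntropy_zero_left (b : ℝ) : pairEntropy 0 b = 0 := by simp [pairEntropy]

lemma pairEntropy_zero_right (a : ℝ) : pairEntropy a 0 = 0 := by simp [pairEntropy]

lemma pairEntropy_eq {a b : ℝ} (ha : 0 ≤ a) (hb : 0 ≤ b) :
    pairEntropy a b = a * -Real.log (a / (a + b)) + b * -Real.log (b / (a + b)) := by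
  rcases ha.eq_or_lt with rfl | ha
  · rcases hb.eq_or_lt with rfl | hb
    · simp [pairEntropy]
    · simp [pairEntropy, hb.ne']
  rcases hb.eq_or_lt with rfl | hb
  · simp [pairEntropy, ha.ne']
  rw [Real.log_div ha.ne' (add_pos ha hb).ne', Real.log_div hb.ne' (add_pos ha hb).ne']
  simp only [pairEntropy, Real.negMulLog]
  ring

lemma mul_neg_log_div_nonneg {a c : ℝ} (ha : 0 ≤ a) (hac : a ≤ c) :
    0 ≤ -Real.log (a / c) := by
  have := Real.log_nonpos (div_nonneg ha (ha.trans hac)) (div_le_one_of_le₀ hac (ha.trans hac))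
  linarith

lemma pairEntropy_nonneg {a b : ℝ} (ha : 0 ≤ a) (hb : 0 ≤ b) : 0 ≤ pairEntropy a b := by
  rw [pairEntropy_eq ha hb]
  exact add_nonneg (mul_nonneg ha (mul_neg_log_div_nonneg ha (by linarith)))
    (mul_nonneg hb (mul_neg_log_div_nonneg hb (by linarith)))

lemma pairEntropy_pos {a b : ℝ} (ha : 0 < a) (hb : 0 < b) : 0 < pairEntropy a b := by
  rw [pairEntropy_eq ha.le hb.le]
  have h1 : Real.log (a / (a + b)) < 0 :=
    Real.log_neg (by positivity) ((div_lt_one (by positivity)).2 (by linarith))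
  exact add_pos_of_pos_of_nonneg (mul_pos ha (by linarith))
    (mul_nonneg hb.le (mul_neg_log_div_nonneg hb.le (by linarith)))

/-- At `t = 0` the loss is `∞` while `Real.log 0 = 0`. The last hypothesis forces `a = 0` there, and
`0 * ∞ = 0` makes the two sides agree. -/
lemma ofReal_mul_logLoss_div {a t c : ℝ} (ha : 0 ≤ a) (ht : 0 ≤ t) (hc : t ≤ c)
    (hat : a ≠ 0 → t ≠ 0) :
    ENNReal.ofReal a * logLoss (t / c) = ENNReal.ofReal (a * -Real.log (t / c)) := by
  rcases ha.eq_or_lt with rfl | ha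
  · simp
  · have ht' : 0 < t := lt_of_le_of_ne ht (hat ha.ne').symm
    rw [logLoss_of_pos (div_pos ht' (ht'.trans_le hc)), ENNReal.ofReal_mul ha.le]

lemma one_sub_div_add {a b : ℝ} (h : a + b ≠ 0) : 1 - a / (a + b) = b / (a + b) := by
  field_simp; ring

lemma ofReal_mul_logLoss_one_sub_div {c a b : ℝ} (hc : 0 ≤ c) (ha : 0 ≤ a) (hb : 0 ≤ b)
    (hcb : c ≠ 0 → b ≠ 0) :
    ENNReal.ofReal c * logLoss (1 - a / (a + b)) =
      ENNReal.ofReal (c * -Real.log (b / (a + b))) := by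
  rcases eq_or_ne c 0 with rfl | h
  · simp
  · have hb' : 0 < b := lt_of_le_of_ne hb (hcb h).symm
    rw [one_sub_div_add (by positivity), ofReal_mul_logLoss_div hc hb (by linarith) hcb]

/-- The proportional bet attains the entropy. -/
lemma pairLoss_div {a b : ℝ} (ha : 0 ≤ a) (hb : 0 ≤ b) :
    ENNReal.ofReal a * logLoss (a / (a + b)) + ENNReal.ofReal b * logLoss (1 - a / (a + b)) =
      ENNReal.ofReal (pairEntropy a b) := by
  rw [ofReal_mul_logLoss_div ha ha (by linarith) id, ofReal_mul_logLoss_one_sub_div hb ha hb id,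
    pairEntropy_eq ha hb, ENNReal.ofReal_add]
  · exact mul_nonneg ha (mul_neg_log_div_nonneg ha (by linarith))
  · exact mul_nonneg hb (mul_neg_log_div_nonneg hb (by linarith))

/-- Gibbs' inequality for two outcomes, in its strict form. -/
lemma pairEntropy_lt {a b x : ℝ} (ha : 0 ≤ a) (hb : 0 ≤ b) (hab : 0 < a + b) (hx0 : 0 ≤ x)
    (hx1 : x ≤ 1) (hx : x ≠ a / (a + b)) :
    ENNReal.ofReal (pairEntropy a b) <
      ENNReal.ofReal a * logLoss x + ENNReal.ofReal b * logLoss (1 - x) := by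
  rcases ha.eq_or_lt with rfl | ha
  · have hb' : 0 < b := by linarith
    have hx' : 0 < x := lt_of_le_of_ne hx0 (by simpa using hx.symm)
    simpa [pairEntropy_zero_left, hb'] using logLoss_pos (by linarith : 1 - x < 1)
  rcases hb.eq_or_lt with rfl | hb
  · have hx' : x < 1 := lt_of_le_of_ne hx1 (by simpa [ha.ne'] using hx)
    simpa [pairEntropy_zero_right, ha] using logLoss_pos hx'
  rcases hx0.eq_or_lt with rfl | hx0
  · simp [logLoss_of_nonpos le_rfl, ENNReal.mul_top, ha]
  rcases hx1.eq_or_lt with rfl | hx1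
  · simp [logLoss_of_nonpos le_rfl, ENNReal.mul_top, hb]
  have hy : 0 < 1 - x := by linarith
  have hlx : Real.log x < 0 := Real.log_neg hx0 hx1
  have hly : Real.log (1 - x) < 0 := Real.log_neg hy (by linarith)
  rw [logLoss_of_pos hx0, logLoss_of_pos hy, ← ENNReal.ofReal_mul ha.le,
    ← ENNReal.ofReal_mul hb.le, ← ENNReal.ofReal_add (by nlinarith) (by nlinarith)]
  -- Strictness comes from here alone: `log t < t - 1` unless `t = 1`, that is, unless `x` is the
  -- proportional bet.
  have h1 : Real.log (x / (a / (a + b))) < x / (a / (a + b)) - 1 := by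
    refine Real.log_lt_sub_one_of_pos (by positivity) fun h => hx ?_
    rwa [div_eq_one_iff_eq (by positivity)] at h
  have h2 : Real.log ((1 - x) / (b / (a + b))) ≤ (1 - x) / (b / (a + b)) - 1 :=
    Real.log_le_sub_one_of_pos (by positivity)
  rw [Real.log_div hx0.ne' (by positivity)] at h1
  rw [Real.log_div hy.ne' (by positivity)] at h2
  have h3 := mul_lt_mul_of_pos_left h1 ha
  have h4 := mul_le_mul_of_nonneg_left h2 hb.le
  -- The linear bounds cancel because `(x, 1 - x)` and the normalised weights both sum to `1`.
  have h5 : a * (x / (a / (a + b)) - 1) + b * ((1 - x) / (b / (a + b)) - 1) = 0 := by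
    field_simp; ring
  rw [pairEntropy_eq ha.le hb.le]
  refine (ENNReal.ofReal_lt_ofReal_iff ?_).2 ?_
  · have := mul_pos ha (neg_pos.2 hlx)
    have := mul_pos hb (neg_pos.2 hly)
    linarith
  · nlinarith

/-- Gibbs' inequality for two outcomes. -/
lemma pairEntropy_le {a b x : ℝ} (ha : 0 ≤ a) (hb : 0 ≤ b) (hx0 : 0 ≤ x) (hx1 : x ≤ 1) :
    ENNReal.ofReal (pairEntropy a b) ≤
      ENNReal.ofReal a * logLoss x + ENNReal.ofReal b * logLoss (1 - x) := by
  rcases (add_nonneg ha hb).eq_or_lt with h | h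
  · obtain rfl : a = 0 := by linarith
    simp [pairEntropy_zero_left]
  by_cases hx : x = a / (a + b)
  · rw [hx, pairLoss_div ha hb]
  · exact (pairEntropy_lt ha hb h hx0 hx1 hx).le

/-- A strict gap in one term would survive in the sum, since the remaining terms of `f` are finite
and can be cancelled. It extracts the equality case of Gibbs' inequality term by term. -/
lemma ENNReal.eq_of_sum_le_sum {ι : Type*} {s : Finset ι} {f g : ι → ENNReal}
    (hfg : ∀ i ∈ s, f i ≤ g i) (hf : ∑ i ∈ s, f i ≠ ⊤) (hsum : ∑ i ∈ s, g i ≤ ∑ i ∈ s, f i)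
    {i : ι} (hi : i ∈ s) : f i = g i := by
  classical
  refine (hfg i hi).antisymm (le_of_not_gt fun hlt => hsum.not_gt ?_)
  rw [← Finset.add_sum_erase s f hi, ← Finset.add_sum_erase s g hi]
  rw [← Finset.add_sum_erase s f hi] at hf
  exact ENNReal.add_lt_add_of_lt_of_le (ENNReal.add_ne_top.1 hf).2 hlt
    (Finset.sum_le_sum fun j hj => hfg j (Finset.mem_of_mem_erase hj))

/-! ## Conditional entropy of the scenario as a function of the prior -/

section PriorEntropy

variable {κ : Type*} (s : Finset κ) (u v : κ → ℝ)

/-- The conditional entropy of a binary variable with prior `P`, given an observation with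
likelihoods `u` and `v`. -/
def priorEntropy (P : ℝ) : ℝ := ∑ k ∈ s, pairEntropy (P * u k) ((1 - P) * v k)

/-- The posterior probability of the first hypothesis. -/
def posteriorProb (P : ℝ) (k : κ) : ℝ := P * u k / (P * u k + (1 - P) * v k)

variable {s u v}

lemma continuous_priorEntropy : Continuous (priorEntropy s u v) := by
  unfold priorEntropy pairEntropy
  refine continuous_finsetSum _ fun k _ => ?_
  exact ((Real.continuous_negMulLog.comp (by fun_prop)).add
    (Real.continuous_negMulLog.comp (by fun_prop))).sub
    (Real.continuous_negMulLog.comp (by fun_prop))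

lemma priorEntropy_nonneg (hu : ∀ k, 0 ≤ u k) (hv : ∀ k, 0 ≤ v k) {P : ℝ} (hP : P ∈ Icc 0 1) :
    0 ≤ priorEntropy s u v P :=
  Finset.sum_nonneg fun k _ =>
    pairEntropy_nonneg (mul_nonneg hP.1 (hu k)) (mul_nonneg (by linarith [hP.2]) (hv k))

lemma ofReal_priorEntropy_eq (hu : ∀ k, 0 ≤ u k) (hv : ∀ k, 0 ≤ v k) {P : ℝ}
    (hP : P ∈ Icc 0 1) :
    ENNReal.ofReal (priorEntropy s u v P) =
      ENNReal.ofReal P * ∑ k ∈ s, ENNReal.ofReal (u k) * logLoss (posteriorProb u v P k) +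
      ENNReal.ofReal (1 - P) * ∑ k ∈ s, ENNReal.ofReal (v k) * logLoss (1 - posteriorProb u v P k) := by
  have h1 : 0 ≤ 1 - P := by linarith [hP.2]
  rw [priorEntropy, ENNReal.ofReal_sum_of_nonneg fun k _ =>
    pairEntropy_nonneg (mul_nonneg hP.1 (hu k)) (mul_nonneg h1 (hv k)), Finset.mul_sum,
    Finset.mul_sum, ← Finset.sum_add_distrib]
  refine Finset.sum_congr rfl fun k _ => ?_
  rw [← pairLoss_div (mul_nonneg hP.1 (hu k)) (mul_nonneg h1 (hv k)), ENNReal.ofReal_mul hP.1,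
    ENNReal.ofReal_mul h1, mul_assoc, mul_assoc, posteriorProb]

/-- An envelope formula: the contributions from differentiating the logarithms cancel, leaving the
difference of the losses in the two scenarios. If a likelihood is zero, the function is identically
zero. -/
lemma hasDerivAt_pairEntropy {P a b : ℝ} (hP0 : 0 < P) (hP1 : P < 1) (ha : 0 ≤ a) (hb : 0 ≤ b) :
    HasDerivAt (fun P => pairEntropy (P * a) ((1 - P) * b))
      (a * -Real.log (P * a / (P * a + (1 - P) * b)) -
        b * -Real.log ((1 - P) * b / (P * a + (1 - P) * b))) P := by
  have hP : 0 < 1 - P := by linarith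
  rcases ha.eq_or_lt with rfl | ha
  · rcases hb.eq_or_lt with rfl | hb
    · simpa [pairEntropy] using hasDerivAt_const P (0 : ℝ)
    · simpa [pairEntropy, hP.ne', hb.ne'] using hasDerivAt_const P (0 : ℝ)
  rcases hb.eq_or_lt with rfl | hb
  · simpa [pairEntropy, hP0.ne', ha.ne'] using hasDerivAt_const P (0 : ℝ)
  have hA : 0 < P * a := mul_pos hP0 ha
  have hB : 0 < (1 - P) * b := mul_pos hP hb
  have dA : HasDerivAt (fun P => P * a) a P := by simpa using (hasDerivAt_id P).mul_const a
  have dB : HasDerivAt (fun P => (1 - P) * b) (-b) P := by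
    simpa using ((hasDerivAt_id P).const_sub 1).mul_const b
  have := (((Real.hasDerivAt_negMulLog hA.ne').comp P dA).add
    ((Real.hasDerivAt_negMulLog hB.ne').comp P dB)).sub
    ((Real.hasDerivAt_negMulLog (add_pos hA hB).ne').comp P (dA.add dB))
  refine this.congr_deriv ?_
  rw [Real.log_div hA.ne' (add_pos hA hB).ne', Real.log_div hB.ne' (add_pos hA hB).ne']
  ring

/-- At an interior critical prior, the expected loss of the posterior bet is the same in both
scenarios. -/
lemma sum_logLoss_posterior_eq (hu : ∀ k, 0 ≤ u k) (hv : ∀ k, 0 ≤ v k) {P : ℝ} (hP0 : 0 < P)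
    (hP1 : P < 1) (hmax : IsLocalMax (priorEntropy s u v) P) :
    ∑ k ∈ s, ENNReal.ofReal (u k) * logLoss (posteriorProb u v P k) =
        ENNReal.ofReal (priorEntropy s u v P) ∧
      ∑ k ∈ s, ENNReal.ofReal (v k) * logLoss (1 - posteriorProb u v P k) =
        ENNReal.ofReal (priorEntropy s u v P) := by
  have hP : 0 < 1 - P := by linarith
  have hA : ∀ k, 0 ≤ P * u k := fun k => mul_nonneg hP0.le (hu k)
  have hB : ∀ k, 0 ≤ (1 - P) * v k := fun k => mul_nonneg hP.le (hv k)
  set f : κ → ℝ := fun k => u k * -Real.log (P * u k / (P * u k + (1 - P) * v k)) with hf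
  set g : κ → ℝ := fun k => v k * -Real.log ((1 - P) * v k / (P * u k + (1 - P) * v k)) with hg
  have hf0 : ∀ k, 0 ≤ f k := fun k =>
    mul_nonneg (hu k) (mul_neg_log_div_nonneg (hA k) (by linarith [hB k]))
  have hg0 : ∀ k, 0 ≤ g k := fun k =>
    mul_nonneg (hv k) (mul_neg_log_div_nonneg (hB k) (by linarith [hA k]))
  have hd : HasDerivAt (priorEntropy s u v) (∑ k ∈ s, (f k - g k)) P :=
    HasDerivAt.fun_sum fun k _ => hasDerivAt_pairEntropy hP0 hP1 (hu k) (hv k)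
  have h0 := hmax.hasDerivAt_eq_zero hd
  rw [Finset.sum_sub_distrib] at h0
  have hE : priorEntropy s u v P = P * ∑ k ∈ s, f k + (1 - P) * ∑ k ∈ s, g k := by
    rw [priorEntropy, Finset.mul_sum, Finset.mul_sum, ← Finset.sum_add_distrib]
    refine Finset.sum_congr rfl fun k _ => ?_
    rw [pairEntropy_eq (hA k) (hB k), hf, hg]
    ring
  -- Criticality says `∑ f = ∑ g`, and the entropy is their average with weights `P` and `1 - P`.
  have hfE : ∑ k ∈ s, f k = priorEntropy s u v P := by rw [hE]; linear_combination (1 - P) * h0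
  have hgE : ∑ k ∈ s, g k = priorEntropy s u v P := by rw [hE]; linear_combination -P * h0
  constructor
  · rw [← hfE, ENNReal.ofReal_sum_of_nonneg fun k _ => hf0 k]
    refine Finset.sum_congr rfl fun k _ => ?_
    exact ofReal_mul_logLoss_div (hu k) (hA k) (by linarith [hB k])
      fun h => mul_ne_zero hP0.ne' h
  · rw [← hgE, ENNReal.ofReal_sum_of_nonneg fun k _ => hg0 k]
    refine Finset.sum_congr rfl fun k _ => ?_
    exact ofReal_mul_logLoss_one_sub_div (hv k) (hA k) (hB k) fun h => mul_ne_zero hP.ne' h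

/-- Bayes' rule multiplies the odds of the prior by the fixed ratio `u k / v k`. Both likelihoods
must be positive, otherwise the posterior is constant for interior priors. -/
lemma posterior_injOn {k : κ} (hu : 0 < u k) (hv : 0 < v k) :
    InjOn (fun P => posteriorProb u v P k) (Icc 0 1) := by
  have pos : ∀ P ∈ Icc (0 : ℝ) 1, 0 < P * u k + (1 - P) * v k := by
    intro P hP
    rcases hP.1.eq_or_lt with rfl | h
    · simpa using hv
    · exact add_pos_of_pos_of_nonneg (mul_pos h hu) (mul_nonneg (by linarith [hP.2]) hv.le)
  intro P hP Q hQ h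
  simp only [posteriorProb] at h
  rw [div_eq_div_iff (pos P hP).ne' (pos Q hQ).ne'] at h
  have : u k * v k * (P - Q) = 0 := by linear_combination h
  rcases mul_eq_zero.1 this with h | h
  · exact absurd h (mul_pos hu hv).ne'
  · linarith

lemma posterior_mem_Icc (hu : ∀ k, 0 ≤ u k) (hv : ∀ k, 0 ≤ v k) {P : ℝ} (hP : P ∈ Icc 0 1)
    (k : κ) : posteriorProb u v P k ∈ Icc (0 : ℝ) 1 := by
  have h1 := mul_nonneg hP.1 (hu k)
  have h2 := mul_nonneg (by linarith [hP.2] : 0 ≤ 1 - P) (hv k)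
  exact ⟨div_nonneg h1 (by linarith), div_le_one_of_le₀ (by linarith) (by linarith)⟩

/-- The entropy vanishes at both ends of the interval and is positive at `1/2` owing to the term
`k`, so a maximiser given by compactness is interior. -/
lemma exists_isMaxOn_priorEntropy (hu : ∀ k, 0 ≤ u k) (hv : ∀ k, 0 ≤ v k) {k : κ} (hk : k ∈ s)
    (huk : 0 < u k) (hvk : 0 < v k) :
    ∃ P : ℝ, 0 < P ∧ P < 1 ∧ IsMaxOn (priorEntropy s u v) (Icc 0 1) P := by
  obtain ⟨P, hP, hmax⟩ := isCompact_Icc.exists_isMaxOn (nonempty_Icc.2 zero_le_one)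
    (continuous_priorEntropy (s := s) (u := u) (v := v)).continuousOn
  have hpos : 0 < priorEntropy s u v P := by
    refine lt_of_lt_of_le ?_ (hmax (⟨by norm_num, by norm_num⟩ : (1 / 2 : ℝ) ∈ Icc (0 : ℝ) 1))
    refine Finset.sum_pos' (fun j _ => ?_) ⟨k, hk, ?_⟩
    · exact pairEntropy_nonneg (mul_nonneg (by norm_num) (hu j))
        (mul_nonneg (by norm_num) (hv j))
    · exact pairEntropy_pos (mul_pos (by norm_num) huk) (mul_pos (by norm_num) hvk)
  refine ⟨P, lt_of_le_of_ne hP.1 ?_, lt_of_le_of_ne hP.2 ?_, hmax⟩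
  · rintro rfl
    simp [priorEntropy, pairEntropy_zero_left] at hpos
  · rintro rfl
    simp [priorEntropy, pairEntropy_zero_right] at hpos

lemma priorEntropy_lt_of_isMaxOn (hu : ∀ k, 0 ≤ u k) (hv : ∀ k, 0 ≤ v k) {k : κ} (hk : k ∈ s)
    (huk : 0 < u k) (hvk : 0 < v k) {P : ℝ} (hP0 : 0 < P) (hP1 : P < 1)
    (hmax : IsMaxOn (priorEntropy s u v) (Icc 0 1) P) {Q : ℝ} (hQ : Q ∈ Icc 0 1) (hQP : Q ≠ P) :
    priorEntropy s u v Q < priorEntropy s u v P := by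
  have hQ' : 0 ≤ 1 - Q := by linarith [hQ.2]
  have hP : P ∈ Icc (0 : ℝ) 1 := ⟨hP0.le, hP1.le⟩
  refine lt_of_le_of_ne (hmax hQ) fun heq => ?_
  obtain ⟨hA, hB⟩ := sum_logLoss_posterior_eq hu hv hP0 hP1 (hmax.isLocalMax (Icc_mem_nhds hP0 hP1))
  -- The bets for `P` lose the entropy at `P` in both scenarios, hence also under the prior `Q`; by
  -- `heq` this is the entropy at `Q`, the least possible loss.
  have hle : ∑ k ∈ s, (ENNReal.ofReal (Q * u k) * logLoss (posteriorProb u v P k) +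
      ENNReal.ofReal ((1 - Q) * v k) * logLoss (1 - posteriorProb u v P k)) ≤
      ∑ k ∈ s, ENNReal.ofReal (pairEntropy (Q * u k) ((1 - Q) * v k)) := by
    rw [← ENNReal.ofReal_sum_of_nonneg fun k _ =>
      pairEntropy_nonneg (mul_nonneg hQ.1 (hu k)) (mul_nonneg hQ' (hv k)), Finset.sum_add_distrib]
    simp_rw [ENNReal.ofReal_mul hQ.1, ENNReal.ofReal_mul hQ', mul_assoc]
    rw [← Finset.mul_sum, ← Finset.mul_sum, hA, hB, ← add_mul, ← ENNReal.ofReal_add hQ.1 hQ',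
      ← heq]
    simp [priorEntropy]
  have hpost := posterior_mem_Icc hu hv hP
  refine absurd (ENNReal.eq_of_sum_le_sum (fun j _ => pairEntropy_le (mul_nonneg hQ.1 (hu j))
    (mul_nonneg hQ' (hv j)) (hpost j).1 (hpost j).2) (by simp) hle hk) (ne_of_lt ?_)
  refine pairEntropy_lt (mul_nonneg hQ.1 (hu k)) (mul_nonneg hQ' (hv k)) ?_ (hpost k).1
    (hpost k).2 fun h => hQP (posterior_injOn huk hvk hQ hP h.symm)
  rcases hQ.1.eq_or_lt with rfl | h
  · simpa using hvk
  · exact add_pos_of_pos_of_nonneg (mul_pos h huk) (mul_nonneg hQ' hvk.le)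

end PriorEntropy

/-! ## Counting samples -/

lemma ones_observe {N M : ℕ} (S : Sampling N M) (b : Bits M) :
    ones (observe S b) = (S.1.filter fun i => b i = true).card := by
  unfold ones observe
  refine Finset.card_bij (fun i _ => S.1.orderEmbOfFin S.2 i) ?_ ?_ ?_
  · intro i hi
    simpa using hi
  · intro i _ j _ h
    simpa using h
  · intro j hj
    rw [Finset.mem_filter] at hj
    obtain ⟨i, rfl⟩ : j ∈ Set.range (S.1.orderEmbOfFin S.2) := by simpa using hj.1
    exact ⟨i, by simpa using hj.2, rfl⟩

lemma ones_le {n : ℕ} (b : Bits n) : ones b ≤ n := by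
  simpa [ones] using Finset.card_le_univ (Finset.univ.filter fun i => b i = true)

/-- The number of `N`-subsets that meet a `K`-subset in exactly `k` points. -/
lemma card_filter_powersetCard_inter {α : Type*} [Fintype α] [DecidableEq α] (T : Finset α)
    (N k : ℕ) (hk : k ≤ N) :
    ((Finset.univ.powersetCard N).filter fun S : Finset α => (S ∩ T).card = k).card =
      T.card.choose k * (Fintype.card α - T.card).choose (N - k) := by
  rw [← Finset.card_compl, ← Finset.card_powersetCard, ← Finset.card_powersetCard,
    ← Finset.card_product]
  refine Finset.card_bij' (fun S _ => (S ∩ T, S \ T)) (fun p _ => p.1 ∪ p.2) ?_ ?_ ?_ ?_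
  · intro S hS
    simp only [Finset.mem_filter, Finset.mem_powersetCard, Finset.subset_univ, true_and] at hS
    simp only [Finset.mem_product, Finset.mem_powersetCard]
    refine ⟨⟨Finset.inter_subset_right, hS.2⟩, fun x hx => ?_, ?_⟩
    · simpa using (Finset.mem_sdiff.1 hx).2
    · have := Finset.card_inter_add_card_sdiff S T
      omega
  · rintro ⟨A, B⟩ hp
    simp only [Finset.mem_product, Finset.mem_powersetCard] at hp
    obtain ⟨⟨hA, hAk⟩, hB, hBk⟩ := hp
    have hd : Disjoint A B := Finset.disjoint_of_subset_left hA
      (Finset.disjoint_of_subset_right hB disjoint_compl_right)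
    have hi : (A ∪ B) ∩ T = A := by
      ext x
      have h1 := @hA x
      have h2 := @hB x
      simp only [Finset.mem_compl] at h2
      simp only [Finset.mem_inter, Finset.mem_union]
      tauto
    simp only [Finset.mem_filter, Finset.mem_powersetCard, Finset.subset_univ, true_and]
    rw [hi, Finset.card_union_of_disjoint hd]
    omega
  · intro S _
    ext x
    simp only [Finset.mem_union, Finset.mem_inter, Finset.mem_sdiff]
    tauto
  · rintro ⟨A, B⟩ hp
    simp only [Finset.mem_product, Finset.mem_powersetCard] at hp
    obtain ⟨⟨hA, -⟩, hB, -⟩ := hp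
    ext x
    · have h1 := @hA x
      have h2 := @hB x
      simp only [Finset.mem_compl] at h2
      simp only [Finset.mem_inter, Finset.mem_union]
      tauto
    · have h1 := @hA x
      have h2 := @hB x
      simp only [Finset.mem_compl] at h2
      simp only [Finset.mem_sdiff, Finset.mem_union]
      tauto

lemma card_sampling_ones_observe {N M : ℕ} (b : Bits M) {k : ℕ} (hk : k ≤ N) :
    (Finset.univ.filter fun S : Sampling N M => ones (observe S b) = k).card =
      (ones b).choose k * (M - ones b).choose (N - k) := by
  have h := card_filter_powersetCard_inter (Finset.univ.filter fun i => b i = true) N k hk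
  rw [Fintype.card_fin] at h
  refine Eq.trans ?_ h
  refine Finset.card_bij (fun S _ => S.1) ?_ ?_ ?_
  · intro S hS
    simp only [Finset.mem_filter, Finset.mem_univ, true_and, ones_observe] at hS
    simp only [Finset.mem_filter, Finset.mem_powersetCard, Finset.subset_univ, true_and]
    refine ⟨S.2, ?_⟩
    rw [← hS]
    congr 1
    ext i
    simp
  · intro S _ S' _ h
    exact Subtype.ext h
  · intro S hS
    simp only [Finset.mem_filter, Finset.mem_powersetCard, Finset.subset_univ, true_and] at hS
    refine ⟨⟨S, hS.1⟩, ?_, rfl⟩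
    simp only [Finset.mem_filter, Finset.mem_univ, true_and, ones_observe]
    rw [← hS.2]
    congr 1
    ext i
    simp

/-- A sample prescribes the bits on the index set and leaves the others free, which is the form
needed for building extensions. -/
lemma observe_eq_iff {N M : ℕ} (S : Sampling N M) (b : Bits M) (d : Bits N) :
    observe S b = d ↔ ∀ i : Fin M, ∀ h : i ∈ S.1, b i = d ((S.1.orderIsoOfFin S.2).symm ⟨i, h⟩) := by
  constructor
  · rintro rfl i h
    simp [observe, Finset.orderEmbOfFin]
  · intro H
    ext i
    have := H (S.1.orderEmbOfFin S.2 i) (Finset.orderEmbOfFin_mem _ _ _)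
    rw [observe, this]
    congr 1
    rw [OrderIso.symm_apply_eq]
    rfl

/-- The number of sequences with `K` ones that extend a given sample. -/
lemma card_bits_observe_eq {N M : ℕ} (S : Sampling N M) (d : Bits N) {K : ℕ} (hK : ones d ≤ K) :
    (Finset.univ.filter fun b : Bits M => ones b = K ∧ observe S b = d).card =
      (M - N).choose (K - ones d) := by
  have hc : (S.1ᶜ).card = M - N := by rw [Finset.card_compl, Fintype.card_fin, S.2]
  rw [← hc, ← Finset.card_powersetCard]
  have split : ∀ b : Bits M, observe S b = d →
      ones b = ones d + (S.1ᶜ.filter fun i => b i = true).card := by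
    rintro b rfl
    rw [ones_observe, ones, ← Finset.card_union_of_disjoint, ← Finset.filter_union,
      Finset.union_compl]
    exact Finset.disjoint_filter_filter disjoint_compl_right
  -- The sequence that carries the sample `d` on `S` and has its remaining ones exactly at the
  -- points of `U` outside `S`.
  let ext' : Finset (Fin M) → Bits M := fun U i =>
    if h : i ∈ S.1 then d ((S.1.orderIsoOfFin S.2).symm ⟨i, h⟩) else decide (i ∈ U)
  have hobs : ∀ U, observe S (ext' U) = d := fun U => by
    rw [observe_eq_iff]
    intro i h
    simp [ext', h]
  have hfil : ∀ U, U ⊆ S.1ᶜ → (S.1ᶜ.filter fun i => ext' U i = true) = U := by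
    intro U hU
    ext i
    have := @hU i
    simp only [Finset.mem_compl] at this
    by_cases h : i ∈ S.1
    · simp [h]; tauto
    · simp [h, ext']
  refine Finset.card_bij' (fun b _ => S.1ᶜ.filter fun i => b i = true) (fun U _ => ext' U)
    ?_ ?_ ?_ ?_
  · intro b hb
    simp only [Finset.mem_filter, Finset.mem_univ, true_and] at hb
    rw [Finset.mem_powersetCard]
    have := split b hb.2
    exact ⟨Finset.filter_subset _ _, by omega⟩
  · intro U hU
    rw [Finset.mem_powersetCard] at hU
    simp only [Finset.mem_filter, Finset.mem_univ, true_and]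
    have := split _ (hobs U)
    rw [hfil U hU.1] at this
    exact ⟨by omega, hobs U⟩
  · intro b hb
    simp only [Finset.mem_filter, Finset.mem_univ, true_and] at hb
    ext i
    by_cases h : i ∈ S.1
    · simp [ext', h, (observe_eq_iff S b d).1 hb.2 i h]
    · simp [ext', h]
  · intro U hU
    rw [Finset.mem_powersetCard] at hU
    exact hfil U hU.1

lemma card_bits_observe_eq_zero {N M : ℕ} (S : Sampling N M) (d : Bits N) {K : ℕ}
    (hK : K < ones d) :
    (Finset.univ.filter fun b : Bits M => ones b = K ∧ observe S b = d).card = 0 := by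
  rw [Finset.card_eq_zero, Finset.filter_eq_empty_iff]
  rintro b - ⟨rfl, rfl⟩
  rw [ones_observe] at hK
  exact hK.not_ge (Finset.card_le_card (Finset.filter_subset_filter _ (Finset.subset_univ _)))

lemma card_bits_ones (n k : ℕ) :
    (Finset.univ.filter fun b : Bits n => ones b = k).card = n.choose k := by
  have h : (Finset.univ.powersetCard k : Finset (Finset (Fin n))).card = n.choose k := by simp
  rw [← h]
  refine Finset.card_bij' (fun b _ => Finset.univ.filter fun i => b i = true)
    (fun U _ i => decide (i ∈ U)) ?_ ?_ ?_ ?_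
  · intro b hb
    rw [Finset.mem_filter] at hb
    exact Finset.mem_powersetCard.2 ⟨Finset.subset_univ _, hb.2⟩
  · intro U hU
    rw [Finset.mem_filter]
    exact ⟨Finset.mem_univ _, by simpa [ones] using (Finset.mem_powersetCard.1 hU).2⟩
  · intro b _
    ext i
    simp
  · intro U _
    ext i
    simp

/-- Both sides count ordered pairs of disjoint subsets of sizes `a` and `b`. -/
lemma Nat.choose_mul_choose_sub (m a b : ℕ) :
    m.choose a * (m - a).choose b = m.choose b * (m - b).choose a := by
  have h1 := Nat.choose_mul (n := m) (Nat.le_add_right a b)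
  have h2 := Nat.choose_mul (n := m) (Nat.le_add_left b a)
  rw [Nat.add_sub_cancel_left] at h1
  rw [Nat.add_sub_cancel_right] at h2
  rw [← h1, ← h2, Nat.choose_symm_add]

/-- Both sides count pairs of an `N`-set and a `K`-set meeting in `k` points. This duality
reconciles drawing the sequence at random with drawing the indices at random. -/
lemma Nat.choose_mul_choose_mul_choose {M N K k : ℕ} (hk : k ≤ N) (hK : k ≤ K) :
    M.choose N * N.choose k * (M - N).choose (K - k) =
      M.choose K * (K.choose k * (M - K).choose (N - k)) := by
  rw [Nat.choose_mul hk, ← mul_assoc, Nat.choose_mul hK, mul_assoc, mul_assoc]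
  congr 1
  have := Nat.choose_mul_choose_sub (M - k) (N - k) (K - k)
  rwa [Nat.sub_sub_sub_cancel_right hk, Nat.sub_sub_sub_cancel_right hK] at this

/-- The probability of a given sample when the sequence is drawn uniformly. -/
lemma card_bits_observe_div {N M : ℕ} (hN : N ≤ M) (S : Sampling N M) (d : Bits N) {K : ℕ}
    (hK : K ≤ M) :
    ((Finset.univ.filter fun b : Bits M => ones b = K ∧ observe S b = d).card : ℝ) /
        M.choose K = hyperProb N K M (ones d) / N.choose (ones d) := by
  have hMK : (M.choose K : ℝ) ≠ 0 := by exact_mod_cast (Nat.choose_pos hK).ne'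
  have hMN : (M.choose N : ℝ) ≠ 0 := by exact_mod_cast (Nat.choose_pos hN).ne'
  have hNk : (N.choose (ones d) : ℝ) ≠ 0 := by exact_mod_cast (Nat.choose_pos (ones_le d)).ne'
  rcases le_or_gt (ones d) K with h | h
  · rw [card_bits_observe_eq S d h, hyperProb, div_div, div_eq_div_iff hMK (mul_ne_zero hMN hNk)]
    have := Nat.choose_mul_choose_mul_choose (M := M) (ones_le d) h
    have h' : (M.choose N : ℝ) * N.choose (ones d) * (M - N).choose (K - ones d) =
      M.choose K * (K.choose (ones d) * (M - K).choose (N - ones d)) := by exact_mod_cast this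
    linear_combination h'
  · rw [card_bits_observe_eq_zero S d h, hyperProb, Nat.choose_eq_zero_of_lt h]
    simp

/-- The bound `k ≤ N` matters: beyond it the truncated `N - k` is `0`, and the formula stays
positive for `k ≤ K`. -/
lemma hyperProb_pos_iff {N K M k : ℕ} (hN : N ≤ M) (hk : k ≤ N) :
    0 < hyperProb N K M k ↔ k ∈ sampleCounts N K M := by
  have hMN : (0 : ℝ) < M.choose N := by exact_mod_cast Nat.choose_pos hN
  rw [hyperProb, div_pos_iff_of_pos_right hMN, sampleCounts, Finset.mem_Icc]
  norm_cast
  rw [Nat.pos_iff_ne_zero, mul_ne_zero_iff, Ne, Ne, Nat.choose_eq_zero_iff,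
    Nat.choose_eq_zero_iff, le_min_iff]
  omega

lemma sampleCounts_subset (N K M : ℕ) : sampleCounts N K M ⊆ Finset.range (N + 1) := by
  intro k hk
  simp only [sampleCounts, Finset.mem_Icc, le_min_iff, Finset.mem_range] at hk ⊢
  omega

/-- Sums over sequences of a function of the number of ones. -/
lemma sum_bits_ones (n : ℕ) (f : ℕ → ENNReal) :
    ∑ d : Bits n, f (ones d) = ∑ k ∈ Finset.range (n + 1), (n.choose k : ENNReal) * f k := by
  rw [← Finset.sum_fiberwise_of_maps_to (s := Finset.univ) (t := Finset.range (n + 1))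
    (g := fun d : Bits n => ones d) fun d _ => Finset.mem_range.2 (Nat.lt_succ_of_le (ones_le d))]
  refine Finset.sum_congr rfl fun k _ => ?_
  rw [Finset.sum_congr rfl fun d hd => by rw [(Finset.mem_filter.1 hd).2], Finset.sum_const,
    card_bits_ones, nsmul_eq_mul]

/-! ## The game in terms of losses -/

/-- The positive part of `C - g` is bounded by `C`, so its integral is finite and no `∞ - ∞` arises.
-/
lemma extExpectation_const_sub {Ω : Type*} [MeasurableSpace Ω] (μ : Measure Ω)
    [IsProbabilityMeasure μ] {C : ℝ} (hC : 0 ≤ C) {g : Ω → ENNReal} (hg : Measurable g) :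
    extExpectation μ (fun ω => (C : EReal) - g ω) = C - (∫⁻ ω, g ω ∂μ : ENNReal) ∧
      extExpectation μ (fun ω => -((C : EReal) - g ω)) =
        -((C : EReal) - (∫⁻ ω, g ω ∂μ : ENNReal)) := by
  have hpos : ∀ ω, ((C : EReal) - g ω).toENNReal = ENNReal.ofReal C - g ω := fun ω => by
    rw [EReal.toENNReal_sub (EReal.coe_ennreal_nonneg _)]
    simp
  have hneg : ∀ ω, (-((C : EReal) - g ω)).toENNReal = g ω - ENNReal.ofReal C := fun ω => by
    rw [EReal.neg_sub (by simp) (by simp), add_comm, ← sub_eq_add_neg,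
      EReal.toENNReal_sub (by exact_mod_cast hC)]
    simp
  -- Pointwise, both integrands are `max C g`.
  have hsum : ∫⁻ ω, (ENNReal.ofReal C - g ω) ∂μ + ∫⁻ ω, g ω ∂μ =
      ENNReal.ofReal C + ∫⁻ ω, (g ω - ENNReal.ofReal C) ∂μ := by
    rw [← lintegral_add_right _ hg]
    simp_rw [tsub_add_eq_max, max_comm (ENNReal.ofReal C), ← tsub_add_eq_max]
    rw [lintegral_add_right _ measurable_const]
    simp [add_comm]
  have hfin : ∫⁻ ω, (ENNReal.ofReal C - g ω) ∂μ ≠ ⊤ := by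
    refine ne_top_of_le_ne_top (b := ENNReal.ofReal C) ENNReal.ofReal_ne_top ?_
    calc ∫⁻ ω, (ENNReal.ofReal C - g ω) ∂μ ≤ ∫⁻ _, ENNReal.ofReal C ∂μ :=
          lintegral_mono fun ω => tsub_le_self
      _ = ENNReal.ofReal C := by simp
  simp only [extExpectation, neg_neg, hpos, hneg]
  generalize ∫⁻ ω, (ENNReal.ofReal C - g ω) ∂μ = p at *
  generalize ∫⁻ ω, (g ω - ENNReal.ofReal C) ∂μ = n at *
  generalize ∫⁻ ω, g ω ∂μ = G at *
  have key : (p : EReal) - n = C - G := by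
    lift p to NNReal using hfin
    induction n with
    | top =>
      obtain rfl : G = ⊤ := by simpa using hsum
      simp
    | coe n =>
      have hG : G ≠ ⊤ := by
        rintro rfl
        rw [add_top] at hsum
        exact ENNReal.add_ne_top.2 ⟨ENNReal.ofReal_ne_top, ENNReal.coe_ne_top⟩ hsum.symm
      lift G to NNReal using hG
      have h := congrArg ENNReal.toReal hsum
      rw [ENNReal.toReal_add (by simp) (by simp), ENNReal.toReal_add (by simp) (by simp),
        ENNReal.toReal_ofReal hC] at h
      simp only [ENNReal.coe_toReal] at h
      have h' : (p : ℝ) - n = C - G := by linarith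
      exact congrArg Real.toEReal h'
  refine ⟨key, ?_⟩
  rw [← key, EReal.neg_sub (by simp) (by simp [hfin]), add_comm, sub_eq_add_neg]

lemma EReal.coe_sub_le_coe_sub_iff (C : ℝ) {x y : ENNReal} :
    (C : EReal) - x ≤ C - y ↔ y ≤ x := by
  induction x with
  | top => simp
  | coe x =>
    induction y with
    | top =>
      simp only [EReal.coe_ennreal_top, EReal.sub_top, le_bot_iff, top_le_iff, ENNReal.coe_ne_top,
        iff_false]
      exact EReal.coe_ne_bot (C - x)
    | coe y =>
      rw [ENNReal.coe_le_coe, ← NNReal.coe_le_coe]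
      have : (C : EReal) - (x : ENNReal) ≤ C - (y : ENNReal) ↔ C - (x : ℝ) ≤ C - y :=
        EReal.coe_le_coe_iff
      rw [this]
      exact sub_le_sub_iff_left C

/-- The logarithmic loss of placing the portion `x` on `A`. -/
def betLoss : Scenario → ℝ → ENNReal
  | Scenario.A, x => logLoss x
  | Scenario.B, x => logLoss (1 - x)

lemma measurable_betLoss (θ : Scenario) : Measurable (betLoss θ) := by
  cases θ
  · exact measurable_logLoss
  · exact measurable_logLoss.comp (measurable_const.sub measurable_id)

section Game

variable {N KA KB M : ℕ}

/-- The logarithmic loss of the first player. -/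
def actionLoss (a : ActionI N M) (c : ActionII KA KB M) : ENNReal :=
  betLoss c.1.1 (a.2 (observe a.1 c.1.2))

lemma log_ofReal_two_mul {x : ℝ} (hx0 : 0 ≤ x) (hx1 : x ≤ 1) :
    ENNReal.log (ENNReal.ofReal (2 * x)) = (Real.log 2 : EReal) - logLoss x := by
  rcases hx0.eq_or_lt with rfl | hx
  · simp [logLoss_of_nonpos le_rfl]
  · rw [ENNReal.log_ofReal_of_pos (by positivity), logLoss_of_pos hx,
      Real.log_mul two_ne_zero hx.ne', EReal.coe_ennreal_ofReal,
      max_eq_left (by linarith [Real.log_nonpos hx0 hx1])]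
    norm_cast
    rw [sub_neg_eq_add]

lemma payoffI_eq (a : ActionI N M) (c : ActionII KA KB M) :
    payoffI a c = (Real.log 2 : EReal) - actionLoss a c := by
  have h := (a.2 (observe a.1 c.1.2)).2
  unfold payoffI finalCapital actionLoss
  match c.1.1 with
  | Scenario.A => exact log_ofReal_two_mul h.1 h.2
  | Scenario.B => exact log_ofReal_two_mul (by linarith [h.2]) (by linarith [h.1])

lemma measurable_actionLoss :
    Measurable fun z : ActionI N M × ActionII KA KB M => actionLoss z.1 z.2 := by
  -- Only the policy ranges over an uncountable set; the other components are finite.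
  refine measurable_from_prod_countable_left fun c => ?_
  refine measurable_from_prod_countable_right fun S => ?_
  have hp : Measurable fun p : Policy N => (p (observe S c.1.2) : ℝ) :=
    measurable_subtype_coe.comp (measurable_pi_apply _)
  exact (measurable_betLoss c.1.1).comp hp

/-- Expected loss of the first player in mixed strategies. -/
def expectedLoss (σ : Measure (ActionI N M)) (τ : Measure (ActionII KA KB M)) : ENNReal :=
  ∫⁻ z, actionLoss z.1 z.2 ∂σ.prod τ

lemma isBGameNash_iff {σ : Measure (ActionI N M)} {τ : Measure (ActionII KA KB M)} :
    IsBGameNash N KA KB M σ τ ↔ IsProbabilityMeasure σ ∧ IsProbabilityMeasure τ ∧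
      (∀ σ' : Measure (ActionI N M), IsProbabilityMeasure σ' →
        expectedLoss σ τ ≤ expectedLoss σ' τ) ∧
      (∀ τ' : Measure (ActionII KA KB M), IsProbabilityMeasure τ' →
        expectedLoss σ τ' ≤ expectedLoss σ τ) := by
  have hlog : 0 ≤ Real.log 2 := Real.log_nonneg one_le_two
  have hI : ∀ (σ : Measure (ActionI N M)) (τ : Measure (ActionII KA KB M)),
      IsProbabilityMeasure σ → IsProbabilityMeasure τ →
      expectedPayoff payoffI σ τ = (Real.log 2 : EReal) - expectedLoss σ τ := by
    intro σ τ _ _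
    simp only [expectedPayoff, payoffI_eq]
    exact (extExpectation_const_sub _ hlog measurable_actionLoss).1
  have hII : ∀ (σ : Measure (ActionI N M)) (τ : Measure (ActionII KA KB M)),
      IsProbabilityMeasure σ → IsProbabilityMeasure τ →
      expectedPayoff payoffII σ τ = -((Real.log 2 : EReal) - expectedLoss σ τ) := by
    intro σ τ _ _
    simp only [expectedPayoff, payoffII, payoffI_eq]
    exact (extExpectation_const_sub _ hlog measurable_actionLoss).2
  unfold IsBGameNash IsNashEquilibrium
  refine and_congr_right fun hσ => and_congr_right fun hτ => and_congr ?_ ?_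
  · refine forall₂_congr fun σ' hσ' => ?_
    rw [hI _ _ hσ' hτ, hI _ _ hσ hτ, EReal.coe_sub_le_coe_sub_iff]
  · refine forall₂_congr fun τ' hτ' => ?_
    rw [hII _ _ hσ hτ', hII _ _ hσ hτ, EReal.neg_le_neg_iff, EReal.coe_sub_le_coe_sub_iff]

lemma expectedLoss_eq_lintegral_left (σ : Measure (ActionI N M))
    (τ : Measure (ActionII KA KB M)) [SFinite τ] :
    expectedLoss σ τ = ∫⁻ a, ∫⁻ c, actionLoss a c ∂τ ∂σ :=
  lintegral_prod _ measurable_actionLoss.aemeasurable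

lemma expectedLoss_eq_lintegral_right (σ : Measure (ActionI N M))
    (τ : Measure (ActionII KA KB M)) [SFinite σ] [SFinite τ] :
    expectedLoss σ τ = ∫⁻ c, ∫⁻ a, actionLoss a c ∂σ ∂τ :=
  lintegral_prod_symm _ measurable_actionLoss.aemeasurable

/-! ## Expected losses of the symmetric strategies -/

lemma lintegral_uniformOn_finset {Ω : Type*} [MeasurableSpace Ω] [MeasurableSingletonClass Ω]
    (s : Finset Ω) (f : Ω → ENNReal) :
    ∫⁻ x, f x ∂uniformOn (s : Set Ω) = (s.card : ENNReal)⁻¹ * ∑ x ∈ s, f x := by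
  rw [uniformOn, ProbabilityTheory.cond, lintegral_smul_measure, lintegral_finset,
    Measure.count_apply_finset, smul_eq_mul]
  simp

lemma nonempty_sampling (hN : N ≤ M) : Nonempty (Sampling N M) := by
  obtain ⟨S, -, hS⟩ := Finset.exists_subset_card_eq (s := (Finset.univ : Finset (Fin M))) (n := N)
    (by simpa using hN)
  exact ⟨⟨S, hS⟩⟩

lemma card_sampling : (Finset.univ : Finset (Sampling N M)).card = M.choose N := by
  simp [Sampling]

instance isProbabilityMeasure_symmetricI_of_nonempty [Nonempty (Sampling N M)]
    (q : ℕ → unitInterval) : IsProbabilityMeasure (symmetricI N M q) := by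
  have := isProbabilityMeasure_uniformOn (Set.finite_univ (α := Sampling N M)) univ_nonempty
  exact Measure.isProbabilityMeasure_map (measurable_of_countable _).aemeasurable

/-- Expected loss in scenario `θ` when betting `q k` after `k` ones. -/
def scenarioLoss (N KA KB M : ℕ) (q : ℕ → unitInterval) (θ : Scenario) : ENNReal :=
  ∑ k ∈ Finset.range (N + 1),
    ENNReal.ofReal (hyperProb N (quota KA KB θ) M k) * betLoss θ (q k)

/-- For any fixed sequence, uniform sampling makes the number of ones hypergeometric, so the
arrangement of the bits is irrelevant. -/
lemma lintegral_actionLoss_symmetricI (hN : N ≤ M) (q : ℕ → unitInterval)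
    (c : ActionII KA KB M) :
    ∫⁻ a, actionLoss a c ∂symmetricI N M q = scenarioLoss N KA KB M q c.1.1 := by
  have hm : Measurable fun a : ActionI N M => actionLoss a c :=
    measurable_actionLoss.comp (measurable_id.prodMk measurable_const)
  have hpos : (0 : ℝ) < M.choose N := by exact_mod_cast Nat.choose_pos hN
  rw [symmetricI, lintegral_map hm (measurable_of_countable _), ← Finset.coe_univ,
    lintegral_uniformOn_finset, card_sampling]
  rw [← Finset.sum_fiberwise_of_maps_to (s := Finset.univ) (t := Finset.range (N + 1))
    (g := fun S : Sampling N M => ones (observe S c.1.2))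
    fun S _ => Finset.mem_range.2 (Nat.lt_succ_of_le (ones_le _)), Finset.mul_sum, scenarioLoss]
  refine Finset.sum_congr rfl fun k hk => ?_
  rw [Finset.sum_congr rfl (g := fun _ => betLoss c.1.1 (q k)) fun S hS => by
      simp only [actionLoss, (Finset.mem_filter.1 hS).2], Finset.sum_const,
    card_sampling_ones_observe _ (Nat.lt_succ_iff.1 (Finset.mem_range.1 hk)), c.2, nsmul_eq_mul,
    ← mul_assoc, hyperProb, ENNReal.ofReal_div_of_pos hpos, ← Nat.cast_mul,
    ENNReal.ofReal_natCast, ENNReal.ofReal_natCast, mul_comm (_⁻¹), ENNReal.div_eq_inv_mul,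
    mul_comm (_⁻¹)]

lemma expectedLoss_symmetricI (hN : N ≤ M) (q : ℕ → unitInterval)
    (τ : Measure (ActionII KA KB M)) [SFinite τ] :
    expectedLoss (symmetricI N M q) τ =
      τ (choosing KA KB M Scenario.A) * scenarioLoss N KA KB M q Scenario.A +
        τ (choosing KA KB M Scenario.B) * scenarioLoss N KA KB M q Scenario.B := by
  have := nonempty_sampling hN
  have hAB : (choosing KA KB M Scenario.A)ᶜ = choosing KA KB M Scenario.B := by
    ext c
    simp only [choosing, mem_compl_iff, mem_ofPred_eq]
    cases c.1.1 <;> simp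
  rw [expectedLoss_eq_lintegral_right]
  simp_rw [lintegral_actionLoss_symmetricI hN]
  rw [← lintegral_add_compl _ (Set.toFinite (choosing KA KB M Scenario.A)).measurableSet, hAB,
    setLIntegral_congr_fun (g := fun _ => scenarioLoss N KA KB M q Scenario.A)
      (Set.toFinite (choosing KA KB M Scenario.A)).measurableSet fun c hc => by rw [hc],
    setLIntegral_congr_fun (g := fun _ => scenarioLoss N KA KB M q Scenario.B)
      (Set.toFinite (choosing KA KB M Scenario.B)).measurableSet fun c hc => by rw [hc],
    setLIntegral_const, setLIntegral_const, mul_comm,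
    mul_comm (τ (choosing KA KB M Scenario.B))]

lemma measure_choosing_add (τ : Measure (ActionII KA KB M)) [IsProbabilityMeasure τ] :
    τ (choosing KA KB M Scenario.A) + τ (choosing KA KB M Scenario.B) = 1 := by
  have hAB : (choosing KA KB M Scenario.A)ᶜ = choosing KA KB M Scenario.B := by
    ext c
    simp only [choosing, mem_compl_iff, mem_ofPred_eq]
    cases c.1.1 <;> simp
  rw [← hAB, measure_add_measure_compl (Set.toFinite _).measurableSet, measure_univ]

lemma sum_choosing (θ : Scenario) (f : Bits M → ENNReal) :
    ∑ c ∈ (choosing KA KB M θ).toFinite.toFinset, f c.1.2 =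
      ∑ b ∈ Finset.univ.filter (fun b : Bits M => ones b = quota KA KB θ), f b := by
  refine Finset.sum_bij (fun c _ => c.1.2) ?_ ?_ ?_ fun _ _ => rfl
  · rintro ⟨⟨θ', b⟩, hb⟩ hc
    obtain rfl : θ' = θ := by simpa [choosing] using hc
    simpa using hb
  · rintro ⟨⟨θ₁, b₁⟩, h₁⟩ hc₁ ⟨⟨θ₂, b₂⟩, h₂⟩ hc₂ h
    obtain rfl : θ₁ = θ := by simpa [choosing] using hc₁
    obtain rfl : θ₂ = θ₁ := by simpa [choosing] using hc₂
    obtain rfl : b₁ = b₂ := h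
    rfl
  · intro b hb
    exact ⟨⟨(θ, b), by simpa using hb⟩, by simp [choosing], rfl⟩

lemma card_choosing (θ : Scenario) :
    ((choosing KA KB M θ).toFinite.toFinset.card : ENNReal) = M.choose (quota KA KB θ) := by
  have := sum_choosing (KA := KA) (KB := KB) (M := M) θ fun _ => 1
  rwa [Finset.sum_const, Finset.sum_const, card_bits_ones, nsmul_one, nsmul_one] at this

/-- Likelihood of a given sample in a scenario. -/
def sampleProb (N KA KB M : ℕ) (θ : Scenario) (d : Bits N) : ℝ :=
  hyperProb N (quota KA KB θ) M (ones d) / N.choose (ones d)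

lemma quota_le (hA : KA ≤ M) (hB : KB ≤ M) (θ : Scenario) : quota KA KB θ ≤ M := by
  cases θ <;> assumption

lemma choosing_nonempty (hA : KA ≤ M) (hB : KB ≤ M) (θ : Scenario) :
    (choosing KA KB M θ).Nonempty := by
  have h : ((choosing KA KB M θ).toFinite.toFinset.card : ENNReal) ≠ 0 := by
    rw [card_choosing]
    exact_mod_cast (Nat.choose_pos (quota_le hA hB θ)).ne'
  rw [Nat.cast_ne_zero, Finset.card_ne_zero] at h
  simpa using h

/-- By `card_bits_observe_div` the law of the sample is the same for every index set; the sampling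
`a.1` therefore drops out of the right-hand side. -/
lemma lintegral_actionLoss_choosing (hN : N ≤ M) (hA : KA ≤ M) (hB : KB ≤ M)
    (a : ActionI N M) (θ : Scenario) :
    ∫⁻ c, actionLoss a c ∂uniformOn (choosing KA KB M θ) =
      ∑ d : Bits N, ENNReal.ofReal (sampleProb N KA KB M θ d) * betLoss θ (a.2 d) := by
  have hK := quota_le hA hB θ
  have hpos : (0 : ℝ) < M.choose (quota KA KB θ) := by exact_mod_cast Nat.choose_pos hK
  rw [show uniformOn (choosing KA KB M θ) =
      uniformOn ((choosing KA KB M θ).toFinite.toFinset : Set (ActionII KA KB M)) by simp,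
    lintegral_uniformOn_finset, card_choosing]
  rw [Finset.sum_congr rfl (g := fun c : ActionII KA KB M =>
      betLoss θ (a.2 (observe a.1 c.1.2))) fun c hc => by
      have : c.1.1 = θ := by simpa [choosing] using hc
      rw [actionLoss, this],
    sum_choosing θ fun b => betLoss θ (a.2 (observe a.1 b)),
    ← Finset.sum_fiberwise_of_maps_to (t := Finset.univ) (g := observe a.1)
      fun _ _ => Finset.mem_univ _, Finset.mul_sum]
  refine Finset.sum_congr rfl fun d _ => ?_
  rw [Finset.sum_congr rfl fun b hb => by rw [(Finset.mem_filter.1 hb).2], Finset.sum_const,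
    Finset.filter_filter, nsmul_eq_mul, sampleProb, ← card_bits_observe_div hN a.1 d hK,
    ENNReal.ofReal_div_of_pos hpos, ENNReal.ofReal_natCast, ENNReal.ofReal_natCast,
    ENNReal.div_eq_inv_mul, mul_assoc]

lemma lintegral_actionLoss_symmetricII (hN : N ≤ M) (hA : KA ≤ M) (hB : KB ≤ M)
    (a : ActionI N M) (P : unitInterval) :
    ∫⁻ c, actionLoss a c ∂symmetricII KA KB M P =
      ∑ d : Bits N,
        (ENNReal.ofReal (P * sampleProb N KA KB M Scenario.A d) * logLoss (a.2 d) +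
          ENNReal.ofReal ((1 - P) * sampleProb N KA KB M Scenario.B d) *
            logLoss (1 - a.2 d)) := by
  rw [symmetricII, lintegral_add_measure, lintegral_smul_measure, lintegral_smul_measure,
    lintegral_actionLoss_choosing hN hA hB, lintegral_actionLoss_choosing hN hA hB, smul_eq_mul,
    smul_eq_mul, Finset.mul_sum, Finset.mul_sum, ← Finset.sum_add_distrib]
  refine Finset.sum_congr rfl fun d _ => ?_
  rw [ENNReal.ofReal_mul P.2.1, ENNReal.ofReal_mul (sub_nonneg.2 P.2.2), mul_assoc, mul_assoc]
  rfl

lemma isProbabilityMeasure_symmetricII (hA : KA ≤ M) (hB : KB ≤ M) (P : unitInterval) :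
    IsProbabilityMeasure (symmetricII KA KB M P) := by
  constructor
  rw [symmetricII, Measure.add_apply, Measure.smul_apply, Measure.smul_apply,
    uniformOn_of_univ (Set.toFinite _) (choosing_nonempty hA hB _),
    uniformOn_of_univ (Set.toFinite _) (choosing_nonempty hA hB _), smul_eq_mul, smul_eq_mul,
    mul_one, mul_one, ← ENNReal.ofReal_add P.2.1 (sub_nonneg.2 P.2.2)]
  simp

lemma symmetricII_choosing_A (hA : KA ≤ M) (hB : KB ≤ M) (P : unitInterval) :
    symmetricII KA KB M P (choosing KA KB M Scenario.A) = ENNReal.ofReal P := by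
  have h0 : uniformOn (choosing KA KB M Scenario.B) (choosing KA KB M Scenario.A) = 0 := by
    rw [uniformOn_eq_zero_iff (Set.toFinite _), Set.eq_empty_iff_forall_notMem]
    rintro c ⟨hc₁, hc₂⟩
    simp only [choosing, mem_ofPred_eq] at hc₁ hc₂
    simp [hc₁] at hc₂
  rw [symmetricII, Measure.add_apply, Measure.smul_apply, Measure.smul_apply, h0,
    uniformOn_self (Set.toFinite _) (choosing_nonempty hA hB _)]
  simp

end Game

/-! ## The entropy of the scenario given the sample -/

section Entropy

variable {N KA KB M : ℕ}

/-- The entropy of the scenario given the number of ones in the sample, for the prior `P`. -/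
def scenarioEntropy (N KA KB M : ℕ) : ℝ → ℝ :=
  priorEntropy (Finset.range (N + 1)) (hyperProb N KA M) (hyperProb N KB M)

lemma scenarioEntropy_nonneg {P : ℝ} (hP : P ∈ Icc 0 1) : 0 ≤ scenarioEntropy N KA KB M P :=
  priorEntropy_nonneg (hyperProb_nonneg N KA M) (hyperProb_nonneg N KB M) hP

lemma hyperProb_eq_zero {K k : ℕ} (hN : N ≤ M) (hk : k ∈ Finset.range (N + 1))
    (h : k ∉ sampleCounts N K M) : hyperProb N K M k = 0 := by
  rw [← hyperProb_pos_iff hN (Nat.lt_succ_iff.1 (Finset.mem_range.1 hk)), not_lt] at h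
  exact h.antisymm (hyperProb_nonneg _ _ _ _)

lemma growthDiff_eq_neg_scenarioEntropy (hN : N ≤ M) {P : ℝ} (hP : P ∈ Icc 0 1) :
    growthDiff N KA KB M P = -scenarioEntropy N KA KB M P := by
  have hP' : 0 ≤ 1 - P := by linarith [hP.2]
  rw [growthDiff, Finset.sum_subset (sampleCounts_subset N KA M) fun k hk h => by
      rw [hyperProb_eq_zero hN hk h, zero_mul],
    Finset.sum_subset (sampleCounts_subset N KB M) fun k hk h => by
      rw [hyperProb_eq_zero hN hk h, zero_mul],
    Finset.mul_sum, Finset.mul_sum, ← Finset.sum_add_distrib, scenarioEntropy, priorEntropy,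
    ← Finset.sum_neg_distrib]
  refine Finset.sum_congr rfl fun k _ => ?_
  rw [pairEntropy_eq (mul_nonneg hP.1 (hyperProb_nonneg _ _ _ _))
    (mul_nonneg hP' (hyperProb_nonneg _ _ _ _))]
  ring

lemma condEntropy_jointLaw {P : ℝ} (hP : P ∈ Icc 0 1) :
    condEntropy (Finset.range (N + 1)) (jointLaw N KA KB M P) =
      scenarioEntropy N KA KB M P := by
  have hP' : 0 ≤ 1 - P := by linarith [hP.2]
  have hsum : ∀ f : Scenario → ℝ, ∑ θ, f θ = f Scenario.A + f Scenario.B := fun f => by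
    simp [Finset.sum, Finset.univ, Fintype.elems]
  rw [condEntropy, scenarioEntropy, priorEntropy]
  refine Finset.sum_congr rfl fun k _ => ?_
  have ha := mul_nonneg hP.1 (hyperProb_nonneg N KA M k)
  have hb := mul_nonneg hP' (hyperProb_nonneg N KB M k)
  rw [pairEntropy_eq ha hb]
  simp only [hsum, jointLaw, Real.negMulLog]
  rcases (add_nonneg ha hb).eq_or_lt with h | h
  · have h1 : P * hyperProb N KA M k = 0 := by linarith
    have h2 : (1 - P) * hyperProb N KB M k = 0 := by linarith
    simp [h1, h2]
  · field_simp

lemma pairEntropy_mul_mul (c a b : ℝ) : pairEntropy (c * a) (c * b) = c * pairEntropy a b := by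
  simp only [pairEntropy, ← mul_add, Real.negMulLog_mul]
  ring

/-- The count is a sufficient statistic: the `N.choose k` samples with `k` ones share its weight
equally, and `pairEntropy` is homogeneous of degree one. -/
lemma ofReal_scenarioEntropy_eq_sum_bits {P : ℝ} (hP : P ∈ Icc 0 1) :
    ENNReal.ofReal (scenarioEntropy N KA KB M P) =
      ∑ d : Bits N, ENNReal.ofReal (pairEntropy (P * sampleProb N KA KB M Scenario.A d)
        ((1 - P) * sampleProb N KA KB M Scenario.B d)) := by
  have hP' : 0 ≤ 1 - P := by linarith [hP.2]
  have h := sum_bits_ones N fun k => ENNReal.ofReal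
    (pairEntropy (P * (hyperProb N KA M k / N.choose k))
      ((1 - P) * (hyperProb N KB M k / N.choose k)))
  refine Eq.trans ?_ h.symm
  rw [scenarioEntropy, priorEntropy, ENNReal.ofReal_sum_of_nonneg fun k _ =>
    pairEntropy_nonneg (mul_nonneg hP.1 (hyperProb_nonneg _ _ _ _))
      (mul_nonneg hP' (hyperProb_nonneg _ _ _ _))]
  refine Finset.sum_congr rfl fun k hk => ?_
  have hpos : (0 : ℝ) < N.choose k := by
    exact_mod_cast Nat.choose_pos (Nat.lt_succ_iff.1 (Finset.mem_range.1 hk))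
  rw [← ENNReal.ofReal_natCast, ← ENNReal.ofReal_mul hpos.le, ← pairEntropy_mul_mul]
  congr 2 <;> field_simp

lemma sampleProb_nonneg (θ : Scenario) (d : Bits N) : 0 ≤ sampleProb N KA KB M θ d :=
  div_nonneg (hyperProb_nonneg _ _ _ _) (Nat.cast_nonneg _)

lemma pairEntropy_sampleProb_le (P : unitInterval) (p : Policy N) (d : Bits N) :
    ENNReal.ofReal (pairEntropy (P * sampleProb N KA KB M Scenario.A d)
        ((1 - P) * sampleProb N KA KB M Scenario.B d)) ≤
      ENNReal.ofReal (P * sampleProb N KA KB M Scenario.A d) * logLoss (p d) +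
        ENNReal.ofReal ((1 - P) * sampleProb N KA KB M Scenario.B d) * logLoss (1 - p d) :=
  pairEntropy_le (mul_nonneg P.2.1 (sampleProb_nonneg _ d))
    (mul_nonneg (sub_nonneg.2 P.2.2) (sampleProb_nonneg _ d)) (p d).2.1 (p d).2.2

/-- Against the symmetric strategy of the second player, every action loses at least the
entropy. -/
lemma scenarioEntropy_le_lintegral_actionLoss (hN : N ≤ M) (hA : KA ≤ M) (hB : KB ≤ M)
    (P : unitInterval) (a : ActionI N M) :
    ENNReal.ofReal (scenarioEntropy N KA KB M P) ≤
      ∫⁻ c, actionLoss a c ∂symmetricII KA KB M P := by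
  rw [ofReal_scenarioEntropy_eq_sum_bits P.2, lintegral_actionLoss_symmetricII hN hA hB]
  exact Finset.sum_le_sum fun d _ => pairEntropy_sampleProb_le P a.2 d

/-- Only the policies given by Bayes' rule lose no more than the entropy. -/
lemma eq_bayesBet_of_lintegral_actionLoss_le (hN : N ≤ M) (hA : KA ≤ M) (hB : KB ≤ M)
    {P : unitInterval} (hP0 : 0 < P) (hP1 : P < 1) {a : ActionI N M}
    (h : ∫⁻ c, actionLoss a c ∂symmetricII KA KB M P ≤
      ENNReal.ofReal (scenarioEntropy N KA KB M P)) {d : Bits N}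
    (hd : ones d ∈ sampleCounts N KA M ∪ sampleCounts N KB M) :
    a.2 d = bayesBet N KA KB M P (ones d) := by
  have hP0' : (0 : ℝ) < P := hP0
  have hP1' : (0 : ℝ) < 1 - P := sub_pos.2 hP1
  rw [ofReal_scenarioEntropy_eq_sum_bits P.2, lintegral_actionLoss_symmetricII hN hA hB] at h
  have heq := ENNReal.eq_of_sum_le_sum (fun d _ => pairEntropy_sampleProb_le P a.2 d)
    (by simp) h (Finset.mem_univ d)
  have hu := hyperProb_nonneg N KA M (ones d)
  have hv := hyperProb_nonneg N KB M (ones d)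
  have hC : (0 : ℝ) < N.choose (ones d) := by exact_mod_cast Nat.choose_pos (ones_le d)
  have hpos : 0 < P * hyperProb N KA M (ones d) + (1 - P) * hyperProb N KB M (ones d) := by
    rw [Finset.mem_union, ← hyperProb_pos_iff hN (ones_le d),
      ← hyperProb_pos_iff hN (ones_le d)] at hd
    rcases hd with hd | hd
    · exact add_pos_of_pos_of_nonneg (mul_pos hP0' hd) (mul_nonneg hP1'.le hv)
    · exact add_pos_of_nonneg_of_pos (mul_nonneg hP0'.le hu) (mul_pos hP1' hd)
  have hA' : P * sampleProb N KA KB M Scenario.A d =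
      P * hyperProb N KA M (ones d) / N.choose (ones d) := (mul_div_assoc _ _ _).symm
  have hB' : (1 - P) * sampleProb N KA KB M Scenario.B d =
      (1 - P) * hyperProb N KB M (ones d) / N.choose (ones d) := (mul_div_assoc _ _ _).symm
  by_contra hne
  refine (pairEntropy_lt (mul_nonneg P.2.1 (sampleProb_nonneg _ d))
    (mul_nonneg hP1'.le (sampleProb_nonneg _ d)) ?_ (a.2 d).2.1 (a.2 d).2.2 ?_).ne heq
  · rw [hA', hB', ← add_div]
    exact div_pos hpos hC
  · rw [hA', hB', ← add_div, div_div_div_cancel_right₀ hC.ne']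
    exact fun h => hne (Subtype.ext h)

lemma scenarioLoss_congr (hN : N ≤ M) {q q' : ℕ → unitInterval}
    (h : ∀ k ∈ sampleCounts N KA M ∪ sampleCounts N KB M, q k = q' k) (θ : Scenario) :
    scenarioLoss N KA KB M q θ = scenarioLoss N KA KB M q' θ := by
  refine Finset.sum_congr rfl fun k hk => ?_
  by_cases hk' : k ∈ sampleCounts N (quota KA KB θ) M
  · rw [h k]
    cases θ
    · exact Finset.mem_union_left _ hk'
    · exact Finset.mem_union_right _ hk'
  · simp [hyperProb_eq_zero hN hk hk']

/-- The Bayesian bets for the prior `P` have the entropy as expected loss if the prior is right. -/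
lemma ofReal_scenarioEntropy_eq (P : unitInterval) :
    ENNReal.ofReal (scenarioEntropy N KA KB M P) =
      ENNReal.ofReal P * scenarioLoss N KA KB M (bayesBet N KA KB M P) Scenario.A +
        ENNReal.ofReal (1 - P) * scenarioLoss N KA KB M (bayesBet N KA KB M P) Scenario.B :=
  ofReal_priorEntropy_eq (hyperProb_nonneg N KA M) (hyperProb_nonneg N KB M) P.2

/-- The prior of maximal entropy. -/
lemma exists_prior_maximising_entropy (hN : N ≤ M)
    (hne : (sampleCounts N KA M ∩ sampleCounts N KB M).Nonempty) :
    ∃ P : unitInterval, 0 < P ∧ P < 1 ∧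
      (∀ Q : unitInterval, Q ≠ P → scenarioEntropy N KA KB M Q < scenarioEntropy N KA KB M P) ∧
      ∀ θ, scenarioLoss N KA KB M (bayesBet N KA KB M P) θ =
        ENNReal.ofReal (scenarioEntropy N KA KB M P) := by
  obtain ⟨k, hk⟩ := hne
  rw [Finset.mem_inter] at hk
  have hkN := sampleCounts_subset N KA M hk.1
  have hkN' := Nat.lt_succ_iff.1 (Finset.mem_range.1 hkN)
  have huk := (hyperProb_pos_iff hN hkN').2 hk.1
  have hvk := (hyperProb_pos_iff hN hkN').2 hk.2
  have hu := hyperProb_nonneg N KA M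
  have hv := hyperProb_nonneg N KB M
  obtain ⟨P, hP0, hP1, hmax⟩ := exists_isMaxOn_priorEntropy hu hv hkN huk hvk
  refine ⟨⟨P, hP0.le, hP1.le⟩, hP0, hP1, fun Q hQ => ?_, fun θ => ?_⟩
  · exact priorEntropy_lt_of_isMaxOn hu hv hkN huk hvk hP0 hP1 hmax Q.2
      fun h => hQ (Subtype.ext h)
  · have h := sum_logLoss_posterior_eq hu hv hP0 hP1 (hmax.isLocalMax (Icc_mem_nhds hP0 hP1))
    cases θ
    · exact h.1
    · exact h.2

/-! ## The Nash equilibria -/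

lemma scenarioEntropy_le_expectedLoss (hN : N ≤ M) (hA : KA ≤ M) (hB : KB ≤ M)
    (P : unitInterval) (σ : Measure (ActionI N M)) [IsProbabilityMeasure σ] :
    ENNReal.ofReal (scenarioEntropy N KA KB M P) ≤ expectedLoss σ (symmetricII KA KB M P) := by
  have := isProbabilityMeasure_symmetricII hA hB P
  rw [expectedLoss_eq_lintegral_left]
  calc ENNReal.ofReal (scenarioEntropy N KA KB M P)
      = ∫⁻ _, ENNReal.ofReal (scenarioEntropy N KA KB M P) ∂σ := by simp
    _ ≤ _ := lintegral_mono (scenarioEntropy_le_lintegral_actionLoss hN hA hB P)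

/-- A strategy that loses the same in both scenarios loses the same against every opponent. -/
lemma expectedLoss_symmetricI_of_scenarioLoss_eq (hN : N ≤ M) {q : ℕ → unitInterval} {V : ENNReal}
    (h : ∀ θ, scenarioLoss N KA KB M q θ = V) (τ : Measure (ActionII KA KB M))
    [IsProbabilityMeasure τ] : expectedLoss (symmetricI N M q) τ = V := by
  rw [expectedLoss_symmetricI hN, h, h, ← add_mul, measure_choosing_add, one_mul]

/-- The hypothesis makes Player I's strategy an equaliser, so Player II is indifferent, while Gibbs'
inequality prevents Player I from losing less than the entropy. -/
lemma isBGameNash_symmetric (hN : N ≤ M) (hA : KA ≤ M) (hB : KB ≤ M) {P : unitInterval}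
    {q : ℕ → unitInterval}
    (h : ∀ θ, scenarioLoss N KA KB M q θ = ENNReal.ofReal (scenarioEntropy N KA KB M P)) :
    IsBGameNash N KA KB M (symmetricI N M q) (symmetricII KA KB M P) := by
  have := nonempty_sampling hN
  have := isProbabilityMeasure_symmetricII hA hB P
  refine isBGameNash_iff.2 ⟨inferInstance, inferInstance, fun σ' _ => ?_, fun τ' _ => ?_⟩
  · rw [expectedLoss_symmetricI_of_scenarioLoss_eq hN h]
    exact scenarioEntropy_le_expectedLoss hN hA hB P σ'
  · rw [expectedLoss_symmetricI_of_scenarioLoss_eq hN h,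
      expectedLoss_symmetricI_of_scenarioLoss_eq hN h]

/-- Interchangeability in a zero-sum game: letting each player deviate to the saddle-point strategy
closes a cycle of inequalities through the value. -/
lemma expectedLoss_eq_of_isBGameNash (hN : N ≤ M) (hA : KA ≤ M) (hB : KB ≤ M) {P : unitInterval}
    (hP : ∀ θ, scenarioLoss N KA KB M (bayesBet N KA KB M P) θ =
      ENNReal.ofReal (scenarioEntropy N KA KB M P))
    {σ : Measure (ActionI N M)} {τ : Measure (ActionII KA KB M)}
    (h : IsBGameNash N KA KB M σ τ) :
    expectedLoss σ τ = ENNReal.ofReal (scenarioEntropy N KA KB M P) ∧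
      expectedLoss σ (symmetricII KA KB M P) =
        ENNReal.ofReal (scenarioEntropy N KA KB M P) := by
  obtain ⟨hσ, hτ, hI, hII⟩ := isBGameNash_iff.1 h
  have := nonempty_sampling hN
  have hlow := scenarioEntropy_le_expectedLoss hN hA hB P σ
  have h1 := hI (symmetricI N M (bayesBet N KA KB M P)) inferInstance
  rw [expectedLoss_symmetricI_of_scenarioLoss_eq hN hP] at h1
  have h2 := hII _ (isProbabilityMeasure_symmetricII hA hB P)
  exact ⟨h1.antisymm (hlow.trans h2), (h2.trans h1).antisymm hlow⟩

lemma ae_eq_bayesBet_of_isBGameNash (hN : N ≤ M) (hA : KA ≤ M) (hB : KB ≤ M) {P : unitInterval}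
    (hP0 : 0 < P) (hP1 : P < 1)
    (hP : ∀ θ, scenarioLoss N KA KB M (bayesBet N KA KB M P) θ =
      ENNReal.ofReal (scenarioEntropy N KA KB M P))
    {σ : Measure (ActionI N M)} {τ : Measure (ActionII KA KB M)}
    (h : IsBGameNash N KA KB M σ τ) :
    ∀ᵐ a ∂σ, ∀ d : Bits N, ones d ∈ sampleCounts N KA M ∪ sampleCounts N KB M →
      a.2 d = bayesBet N KA KB M P (ones d) := by
  have hσ := (isBGameNash_iff.1 h).1
  have := isProbabilityMeasure_symmetricII hA hB P
  have heq := (expectedLoss_eq_of_isBGameNash hN hA hB hP h).2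
  rw [expectedLoss_eq_lintegral_left] at heq
  -- The loss is bounded below pointwise by its own average, so it equals that bound almost surely.
  have hae := ae_eq_of_ae_le_of_lintegral_le (μ := σ)
    (Filter.Eventually.of_forall (scenarioEntropy_le_lintegral_actionLoss hN hA hB P))
    (by simp) measurable_actionLoss.lintegral_prod_right'.aemeasurable (by simp [heq])
  filter_upwards [hae] with a ha d hd
  exact eq_bayesBet_of_lintegral_actionLoss_le hN hA hB hP0 hP1 ha.symm.le hd

/-- Let `Q` be the actual probability of `A`. Deviating to the Bayes bets for `Q` would lose only
the entropy at `Q`, so this is at least the value, which is the strict maximum at `P`. -/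
lemma measure_choosing_of_isBGameNash (hN : N ≤ M) (hA : KA ≤ M) (hB : KB ≤ M)
    {P : unitInterval}
    (hmax : ∀ Q : unitInterval, Q ≠ P →
      scenarioEntropy N KA KB M Q < scenarioEntropy N KA KB M P)
    (hP : ∀ θ, scenarioLoss N KA KB M (bayesBet N KA KB M P) θ =
      ENNReal.ofReal (scenarioEntropy N KA KB M P))
    {σ : Measure (ActionI N M)} {τ : Measure (ActionII KA KB M)}
    (h : IsBGameNash N KA KB M σ τ) :
    τ (choosing KA KB M Scenario.A) = ENNReal.ofReal P ∧
      τ (choosing KA KB M Scenario.B) = ENNReal.ofReal (1 - P) := by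
  obtain ⟨hσ, hτ, hI, -⟩ := isBGameNash_iff.1 h
  have := nonempty_sampling hN
  let Q : unitInterval := ⟨(τ (choosing KA KB M Scenario.A)).toReal, ENNReal.toReal_nonneg,
    ENNReal.toReal_le_of_le_ofReal zero_le_one (by simpa using prob_le_one)⟩
  have hQA : τ (choosing KA KB M Scenario.A) = ENNReal.ofReal Q :=
    (ENNReal.ofReal_toReal (measure_ne_top _ _)).symm
  have hQB : τ (choosing KA KB M Scenario.B) = ENNReal.ofReal (1 - Q) := by
    rw [ENNReal.ofReal_sub _ Q.2.1, ← hQA, ENNReal.ofReal_one, ← measure_choosing_add τ,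
      ENNReal.add_sub_cancel_left (measure_ne_top _ _)]
  have hle := hI (symmetricI N M (bayesBet N KA KB M Q)) inferInstance
  rw [(expectedLoss_eq_of_isBGameNash hN hA hB hP h).1, expectedLoss_symmetricI hN, hQA, hQB,
    ← ofReal_scenarioEntropy_eq, ENNReal.ofReal_le_ofReal_iff (scenarioEntropy_nonneg Q.2)] at hle
  have hQP : Q = P := by
    by_contra hne
    exact (hmax Q hne).not_ge hle
  rw [hQA, hQB, hQP]
  exact ⟨rfl, rfl⟩

lemma exists_ones_eq {n k : ℕ} (hk : k ≤ n) : ∃ d : Bits n, ones d = k := by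
  have h : (Finset.univ.filter fun b : Bits n => ones b = k).card ≠ 0 := by
    rw [card_bits_ones]
    exact (Nat.choose_pos hk).ne'
  obtain ⟨d, hd⟩ := Finset.card_ne_zero.1 h
  exact ⟨d, (Finset.mem_filter.1 hd).2⟩

end Entropy

theorem mainTheorem2 (N KA KB M : ℕ) (hN : N ≤ M) (hAB : KA ≤ KB) (hB : KB ≤ M)
    (hne : (sampleCounts N KA M ∩ sampleCounts N KB M).Nonempty) :
    ∃ P : unitInterval, 0 < P ∧ P < 1 ∧
      -- `P` is the unique minimiser of the growth rate difference
      (∀ Q : unitInterval, Q ≠ P → growthDiff N KA KB M P < growthDiff N KA KB M Q) ∧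
      -- the growth rate difference is minus the conditional entropy
      (∀ Q : unitInterval, growthDiff N KA KB M Q =
        -condEntropy (Finset.range (N + 1)) (jointLaw N KA KB M Q)) ∧
      -- the described profile is a Nash equilibrium; bets after impossible counts are arbitrary
      (∀ q : ℕ → unitInterval,
        (∀ k ∈ sampleCounts N KA M ∪ sampleCounts N KB M, q k = bayesBet N KA KB M P k) →
          IsBGameNash N KA KB M (symmetricI N M q) (symmetricII KA KB M P)) ∧
      -- it is the only Nash equilibrium in symmetric strategies
      (∀ (Q : unitInterval) (q : ℕ → unitInterval),
        IsBGameNash N KA KB M (symmetricI N M q) (symmetricII KA KB M Q) →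
          Q = P ∧
          ∀ k ∈ sampleCounts N KA M ∪ sampleCounts N KB M, q k = bayesBet N KA KB M P k) ∧
      -- every Nash equilibrium has the same scenario probabilities and the same bets
      (∀ (σ : Measure (ActionI N M)) (τ : Measure (ActionII KA KB M)),
        IsBGameNash N KA KB M σ τ →
          τ (choosing KA KB M Scenario.A) = ENNReal.ofReal P ∧
          τ (choosing KA KB M Scenario.B) = ENNReal.ofReal (1 - P) ∧
          ∀ᵐ a ∂σ, ∀ d : Bits N, ones d ∈ sampleCounts N KA M ∪ sampleCounts N KB M →
            a.2 d = bayesBet N KA KB M P (ones d)) := by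
  have hA : KA ≤ M := hAB.trans hB
  obtain ⟨P, hP0, hP1, hmax, hP⟩ := exists_prior_maximising_entropy hN hne
  refine ⟨P, hP0, hP1, fun Q hQ => ?_, fun Q => ?_, fun q hq => ?_, fun Q q h => ⟨?_, ?_⟩,
    fun σ τ h => ?_⟩
  · rw [growthDiff_eq_neg_scenarioEntropy hN P.2, growthDiff_eq_neg_scenarioEntropy hN Q.2]
    exact neg_lt_neg (hmax Q hQ)
  · rw [growthDiff_eq_neg_scenarioEntropy hN Q.2, condEntropy_jointLaw Q.2]
  · exact isBGameNash_symmetric hN hA hB fun θ => (scenarioLoss_congr hN hq θ).trans (hP θ)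
  · have hQ := (measure_choosing_of_isBGameNash hN hA hB hmax hP h).1
    rw [symmetricII_choosing_A hA hB, ENNReal.ofReal_eq_ofReal_iff Q.2.1 P.2.1] at hQ
    exact Subtype.ext hQ
  · intro k hk
    have hkN : k ≤ N := Nat.lt_succ_iff.1 (Finset.mem_range.1
      (Finset.union_subset (sampleCounts_subset N KA M) (sampleCounts_subset N KB M) hk))
    obtain ⟨d, rfl⟩ := exists_ones_eq hkN
    have := nonempty_sampling hN
    -- Under `symmetricI` the policy is the same for every sampled set, so one sampling set in the
    -- almost sure event suffices to read off `q`.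
    have hae := ae_of_ae_map (measurable_of_countable _).aemeasurable
      (ae_eq_bayesBet_of_isBGameNash hN hA hB hP0 hP1 hP h)
    have := isProbabilityMeasure_uniformOn (Set.finite_univ (α := Sampling N M)) univ_nonempty
    obtain ⟨S, hS⟩ := hae.exists
    exact hS d hk
  · obtain ⟨h1, h2⟩ := measure_choosing_of_isBGameNash hN hA hB hmax hP h
    exact ⟨h1, h2, ae_eq_bayesBet_of_isBGameNash hN hA hB hP0 hP1 hP h⟩

end
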